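/- Let $\mathcal H$ be a separable complex Hilbert space and let $U$ and $U_0$ be unitary operators on $\mathcal H$ such that $U-U_0$ is a Hilbert–Schmidt operator. Then there exists a bounded self-adjoint operator $A$ on $\mathcal H$ which is Hilbert–Schmidt, has spectrum $\sigma(A)\subseteq(-\pi,\pi]$, and satisfies $$U=e^{iA}U_0\qquad\text{and}\qquad \|A\|_2\le\frac{\pi}{2}\,\|U-U_0\|_2 .$$ Here a bounded operator $T$ is Hilbert–Schmidt if $\|T\|_2^2=\sum_i\|Tf_i\|^2<\infty$ for an orthonormal basis $(f_i)$ of $\mathcal H$; neither this condition nor the value of the Hilbert–Schmidt norm $\|T\|_2$ depends on the basis. -/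

import Mathlib

open scoped ENNReal NNReal

section HilbertSchmidt

variable {H : Type*} [NormedAddCommGroup H] [InnerProductSpace ℂ H] [CompleteSpace H]

/-- The index set of a chosen orthonormal (Hilbert) basis of `H`. -/
def hsIndex (H : Type*) [NormedAddCommGroup H] [InnerProductSpace ℂ H] [CompleteSpace H] :
    Set H :=
  Classical.choose (exists_hilbertBasis ℂ H)

/-- A chosen orthonormal (Hilbert) basis of `H`. By `isHilbertSchmidt_iff` and `hsNorm_eq` below,
nothing depends on this choice. -/
noncomputable def hsBasis (H : Type*) [NormedAddCommGroup H] [InnerProductSpace ℂ H]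
    [CompleteSpace H] : HilbertBasis (hsIndex H) ℂ H :=
  Classical.choose (Classical.choose_spec (exists_hilbertBasis ℂ H))

/-- `T` is a Hilbert-Schmidt operator: the series `∑ i, ‖T (e i)‖ ^ 2` over an orthonormal basis
`e` converges. -/
def IsHilbertSchmidt (T : H →L[ℂ] H) : Prop :=
  Summable fun i => ‖T (hsBasis H i)‖ ^ 2

/-- The Hilbert-Schmidt norm `(∑ i, ‖T (e i)‖ ^ 2) ^ (1 / 2)`, with `e` an orthonormal basis
(meaningful when `T` is Hilbert-Schmidt). -/
noncomputable def hsNorm (T : H →L[ℂ] H) : ℝ :=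
  Real.sqrt (∑' i, ‖T (hsBasis H i)‖ ^ 2)

/-- Parseval's identity, with values in `[0, ∞]`. -/
theorem parseval_enorm {ι : Type*} (b : HilbertBasis ι ℂ H) (x : H) :
    ∑' i, ‖inner ℂ (b i) x‖ₑ ^ 2 = ‖x‖ₑ ^ 2 := by
  have h : HasSum (fun i => ‖inner ℂ (b i) x‖₊ ^ 2) (‖x‖₊ ^ 2) := by
    rw [← NNReal.hasSum_coe]
    have h2 : HasSum (fun i => inner ℂ x (b i) * inner ℂ (b i) x) (inner ℂ x x) :=
      b.hasSum_inner_mul_inner x x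
    have h3 := Complex.hasSum_re h2
    have h4 : (inner ℂ x x : ℂ).re = ‖x‖ ^ 2 := by
      rw [inner_self_eq_norm_sq_to_K]
      norm_cast
    rw [h4] at h3
    convert h3 using 1
    · funext i
      rw [← inner_conj_symm x (b i), Complex.conj_mul']
      norm_cast
    · simp
  have := (ENNReal.hasSum_coe.mpr h).tsum_eq
  simpa [enorm_eq_nnnorm] using this

/-- `∑ i, ‖T (b i)‖ ^ 2 = ∑ j, ‖T* (c j)‖ ^ 2` in `[0, ∞]` for orthonormal bases `b`, `c`. -/
theorem tsum_enorm_adjoint {ι κ : Type*} (b : HilbertBasis ι ℂ H) (c : HilbertBasis κ ℂ H)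
    (T : H →L[ℂ] H) :
    ∑' i, ‖T (b i)‖ₑ ^ 2 = ∑' j, ‖ContinuousLinearMap.adjoint T (c j)‖ₑ ^ 2 := by
  have h1 : ∀ i, ‖T (b i)‖ₑ ^ 2 = ∑' j, ‖inner ℂ (c j) (T (b i))‖ₑ ^ 2 :=
    fun i => (parseval_enorm c _).symm
  have h2 : ∀ j, ‖ContinuousLinearMap.adjoint T (c j)‖ₑ ^ 2
      = ∑' i, ‖inner ℂ (b i) (ContinuousLinearMap.adjoint T (c j))‖ₑ ^ 2 :=
    fun j => (parseval_enorm b _).symm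
  simp_rw [h1, h2]
  rw [ENNReal.tsum_comm]
  refine tsum_congr fun j => tsum_congr fun i => ?_
  rw [ContinuousLinearMap.adjoint_inner_right, enorm_eq_nnnorm, enorm_eq_nnnorm,
    show ‖inner ℂ (c j) (T (b i))‖₊ = ‖inner ℂ (T (b i)) (c j)‖₊ from
      NNReal.eq (norm_inner_symm _ _)]

theorem tsum_enorm_basis {ι κ : Type*} (b : HilbertBasis ι ℂ H) (c : HilbertBasis κ ℂ H)
    (T : H →L[ℂ] H) : ∑' i, ‖T (b i)‖ₑ ^ 2 = ∑' j, ‖T (c j)‖ₑ ^ 2 :=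
  (tsum_enorm_adjoint b c T).trans (tsum_enorm_adjoint c c T).symm

theorem summable_iff_tsum_enorm {E ι : Type*} [NormedAddCommGroup E] (f : ι → E) :
    (Summable fun i => ‖f i‖ ^ 2) ↔ ∑' i, ‖f i‖ₑ ^ 2 ≠ ∞ := by
  have h : ∀ i, ‖f i‖ₑ ^ 2 = ((‖f i‖₊ ^ 2 : ℝ≥0) : ℝ≥0∞) := fun i => by
    simp [enorm_eq_nnnorm]
  simp_rw [h]
  rw [ENNReal.tsum_coe_ne_top_iff_summable, ← NNReal.summable_coe]
  simp

theorem tsum_eq_toReal_tsum_enorm {E ι : Type*} [NormedAddCommGroup E] (f : ι → E) :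
    ∑' i, ‖f i‖ ^ 2 = (∑' i, ‖f i‖ₑ ^ 2).toReal := by
  rw [ENNReal.tsum_toReal_eq (fun i => by simp [enorm_eq_nnnorm])]
  simp

/-- Being Hilbert-Schmidt may be tested on any orthonormal basis. -/
theorem isHilbertSchmidt_iff {ι : Type*} (b : HilbertBasis ι ℂ H) (T : H →L[ℂ] H) :
    IsHilbertSchmidt T ↔ Summable fun i => ‖T (b i)‖ ^ 2 := by
  rw [IsHilbertSchmidt, summable_iff_tsum_enorm, summable_iff_tsum_enorm,
    tsum_enorm_basis (hsBasis H) b]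

/-- The Hilbert-Schmidt norm may be computed in any orthonormal basis. -/
theorem hsNorm_eq {ι : Type*} (b : HilbertBasis ι ℂ H) (T : H →L[ℂ] H) :
    hsNorm T = Real.sqrt (∑' i, ‖T (b i)‖ ^ 2) := by
  rw [hsNorm, tsum_eq_toReal_tsum_enorm, tsum_eq_toReal_tsum_enorm,
    tsum_enorm_basis (hsBasis H) b]

end HilbertSchmidt

/-!
Put `W = U U₀*`, a unitary with `W - 1 = (U - U₀) U₀*`, so that `W - 1` is Hilbert-Schmidt with
the Hilbert-Schmidt norm of `U - U₀`. The operator sought is `A = arg W`, formed with the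
continuous functional calculus.

The principal argument is discontinuous at `-1`, which may well be a point of `σ(W)`. But then it
is an isolated one: `finite_spectrum_of_isHilbertSchmidt_sub_one` shows that only finitely many
points of `σ(W)` have distance more than `1` from `1`. Were there infinitely many, bump functions
`fₙ` with disjoint supports in `σ(W)`, living on `|z - 1| > 1`, would give an orthonormal sequence
`vₙ` in the ranges of the `fₙ(W)` with `‖(W - 1) vₙ‖ ≥ 1`, which the Hilbert-Schmidt property
forbids. So `arg` is continuous on `σ(W)`; the functional calculus then yields self-adjointness,
`exp (i A) = W` and, by spectral mapping, `σ(A) ⊆ (-π, π]`.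

On the unit circle `|arg z| ≤ (π / 2) |z - 1|`, chord against arc. By `norm_cfc_apply_le` this
passes to the pointwise bound `‖A x‖ ≤ (π / 2) ‖(W - 1) x‖`, and summing the squares over an
orthonormal basis gives both the Hilbert-Schmidt property of `A` and the bound on its norm.
-/

section Lemmas

variable {H : Type*} [NormedAddCommGroup H] [InnerProductSpace ℂ H] [CompleteSpace H]

/-! ### Hilbert-Schmidt operators -/

/-- Passing to adjoints turns right multiplication by `star V` into left multiplication by `V`,
which is isometric. -/
theorem tsum_enorm_mul_star_unitary {ι : Type*} (b : HilbertBasis ι ℂ H) (T : H →L[ℂ] H)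
    {V : H →L[ℂ] H} (hV : V ∈ unitary (H →L[ℂ] H)) :
    ∑' i, ‖(T * star V) (b i)‖ₑ ^ 2 = ∑' i, ‖T (b i)‖ₑ ^ 2 := by
  rw [tsum_enorm_adjoint b b, tsum_enorm_adjoint b b T]
  refine tsum_congr fun i => ?_
  rw [← ContinuousLinearMap.star_eq_adjoint, star_mul, star_star,
    ContinuousLinearMap.star_eq_adjoint, mul_apply_eq_comp]
  congr 1
  rw [enorm_eq_nnnorm, enorm_eq_nnnorm]
  congr 1
  exact NNReal.eq (ContinuousLinearMap.norm_map_of_mem_unitary hV _)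

theorem isHilbertSchmidt_mul_star_unitary {T V : H →L[ℂ] H} (hV : V ∈ unitary (H →L[ℂ] H)) :
    IsHilbertSchmidt (T * star V) ↔ IsHilbertSchmidt T := by
  rw [IsHilbertSchmidt, IsHilbertSchmidt, summable_iff_tsum_enorm, summable_iff_tsum_enorm,
    tsum_enorm_mul_star_unitary _ _ hV]

theorem hsNorm_mul_star_unitary (T : H →L[ℂ] H) {V : H →L[ℂ] H}
    (hV : V ∈ unitary (H →L[ℂ] H)) : hsNorm (T * star V) = hsNorm T := by
  rw [hsNorm, hsNorm, tsum_eq_toReal_tsum_enorm, tsum_eq_toReal_tsum_enorm,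
    tsum_enorm_mul_star_unitary _ _ hV]

theorem isHilbertSchmidt_of_norm_le {S T : H →L[ℂ] H} {c : ℝ}
    (h : ∀ x, ‖S x‖ ≤ c * ‖T x‖) (hT : IsHilbertSchmidt T) : IsHilbertSchmidt S := by
  refine Summable.of_nonneg_of_le (fun _ => by positivity) (fun i => ?_)
    (Summable.mul_left (c ^ 2) hT)
  rw [← mul_pow]
  exact pow_le_pow_left₀ (norm_nonneg _) (h _) 2

theorem hsNorm_le_of_norm_le {S T : H →L[ℂ] H} {c : ℝ} (hc : 0 ≤ c)
    (h : ∀ x, ‖S x‖ ≤ c * ‖T x‖) (hT : IsHilbertSchmidt T) : hsNorm S ≤ c * hsNorm T := by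
  rw [hsNorm, hsNorm, ← Real.sqrt_sq hc, ← Real.sqrt_mul (sq_nonneg c), ← tsum_mul_left]
  refine Real.sqrt_le_sqrt ((isHilbertSchmidt_of_norm_le h hT).tsum_le_tsum (fun i => ?_)
    (Summable.mul_left (c ^ 2) hT))
  rw [← mul_pow]
  exact pow_le_pow_left₀ (norm_nonneg _) (h _) 2

/-- A Hilbert-Schmidt operator cannot be bounded below on an infinite orthonormal family. -/
theorem finite_of_orthonormal_of_one_le {ι : Type*} {T : H →L[ℂ] H} (hT : IsHilbertSchmidt T)
    {v : ι → H} (hv : Orthonormal ℂ v) (h : ∀ i, 1 ≤ ‖T (v i)‖) : Finite ι := by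
  obtain ⟨w, b, hw, hb⟩ := hv.toSubtypeRange.exists_hilbertBasis_extension
  have hinj : Function.Injective fun i => (⟨v i, hw ⟨i, rfl⟩⟩ : w) := fun i j hij =>
    hv.linearIndependent.injective (congrArg Subtype.val hij)
  have hs : Summable fun i => ‖T (v i)‖ ^ 2 := by
    have := ((isHilbertSchmidt_iff b T).mp hT).comp_injective hinj
    simpa [Function.comp_def, hb] using this
  have h1 : Summable fun _ : ι => (1 : ℝ) :=
    hs.of_nonneg_of_le (fun _ => zero_le_one) fun i => one_le_pow₀ (h i)
  exact Finite.of_summable_const one_pos h1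

/-! ### Functional calculus on vectors -/

/-- The difference of the squared norms is `‖s(a) x‖ ^ 2` with `s = (|g|² - |f|²) ^ (1 / 2)`. -/
theorem norm_cfc_apply_le {a : H →L[ℂ] H} [IsStarNormal a] {f g : ℂ → ℂ}
    (hf : ContinuousOn f (spectrum ℂ a)) (hg : ContinuousOn g (spectrum ℂ a))
    (h : ∀ z ∈ spectrum ℂ a, ‖f z‖ ≤ ‖g z‖) (x : H) : ‖cfc f a x‖ ≤ ‖cfc g a x‖ := by
  set s : ℂ → ℂ := fun z => ((Real.sqrt (‖g z‖ ^ 2 - ‖f z‖ ^ 2) : ℝ) : ℂ) with hs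
  have hsc : ContinuousOn s (spectrum ℂ a) := by fun_prop
  have key : star (cfc g a) * cfc g a =
      star (cfc f a) * cfc f a + star (cfc s a) * cfc s a := by
    rw [← cfc_star, ← cfc_star, ← cfc_star, ← cfc_mul .., ← cfc_mul .., ← cfc_mul ..,
      ← cfc_add ..]
    refine cfc_congr fun z hz => ?_
    have h0 : 0 ≤ ‖g z‖ ^ 2 - ‖f z‖ ^ 2 :=
      sub_nonneg.mpr (pow_le_pow_left₀ (norm_nonneg _) (h z hz) 2)
    have h1 : ‖s z‖ ^ 2 = ‖g z‖ ^ 2 - ‖f z‖ ^ 2 := by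
      rw [hs, Complex.norm_real, Real.norm_eq_abs, sq_abs, Real.sq_sqrt h0]
    simp only [RCLike.star_def, Complex.conj_mul']
    norm_cast
    rw [h1]
    ring
  have hn : ∀ S : H →L[ℂ] H, RCLike.re (inner ℂ ((star S * S) x) x) = ‖S x‖ ^ 2 := fun S => by
    rw [mul_apply_eq_comp, ContinuousLinearMap.star_eq_adjoint,
      ContinuousLinearMap.adjoint_inner_left, inner_self_eq_norm_sq]
  have h2 := congrArg (fun S : H →L[ℂ] H => RCLike.re (inner ℂ (S x) x)) key
  simp only [add_apply, inner_add_left, map_add, hn] at h2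
  exact le_of_sq_le_sq (by nlinarith [sq_nonneg ‖cfc s a x‖]) (norm_nonneg _)

/-! ### The spectrum of a unitary Hilbert-Schmidt perturbation of the identity -/

/-- Any normal `W` with `W - 1` Hilbert-Schmidt has only finitely many spectral points at distance
more than `1` from `1`. -/
theorem finite_spectrum_of_isHilbertSchmidt_sub_one {W : H →L[ℂ] H} [hW : IsStarNormal W]
    (hT : IsHilbertSchmidt (W - 1)) : {z ∈ spectrum ℂ W | 1 < ‖z - 1‖}.Finite := by
  set X : Set ℂ := {z ∈ spectrum ℂ W | 1 < ‖z - 1‖} with hX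
  by_contra hinf
  have : Infinite X := Set.infinite_coe_iff.mpr hinf
  obtain ⟨O, hOinf, hOo, hOd⟩ := exists_seq_infinite_isOpen_pairwise_disjoint X
  choose p hp using fun n => (hOinf n).nonempty
  choose V hVo hVO using fun n => isOpen_induced_iff.mp (hOo n)
  have hpV : ∀ n, (p n : ℂ) ∈ V n := fun n => by
    have := hp n
    rwa [← hVO n] at this
  have hu : ∀ n, ∃ u : C(ℂ, ℝ), Set.EqOn u 0 (V n)ᶜ ∧ Set.EqOn u 1 {(p n : ℂ)} := fun n => by
    obtain ⟨u, h0, h1, -⟩ := exists_continuous_zero_one_of_isClosed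
      (hVo n).isClosed_compl (isClosed_singleton (x := (p n : ℂ)))
      (Set.disjoint_singleton_right.mpr fun h => h (hpV n))
    exact ⟨u, h0, h1⟩
  choose u hu0 hu1 using hu
  -- The second factor confines the support to the region `1 < ‖z - 1‖`.
  let f : ℕ → ℂ → ℂ := fun n z => ((u n z * max 0 (‖z - 1‖ - 1) : ℝ) : ℂ)
  have hfc : ∀ n, Continuous (f n) := fun n => by fun_prop
  have hf0 : ∀ n z, ‖z - 1‖ ≤ 1 → f n z = 0 := fun n z hz => by
    simp [f, max_eq_left (sub_nonpos.mpr hz)]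
  have hfp : ∀ n, f n (p n) ≠ 0 := fun n => by
    have h1 : u n (p n) = 1 := hu1 n rfl
    have h2 : 0 < ‖(p n : ℂ) - 1‖ - 1 := sub_pos.mpr (p n).2.2
    simp only [f, h1, one_mul, max_eq_right h2.le]
    exact Complex.ofReal_ne_zero.mpr h2.ne'
  have hfm : ∀ m n, m ≠ n → ∀ z ∈ spectrum ℂ W, f m z * f n z = 0 := fun m n hmn z hz => by
    by_cases hz1 : ‖z - 1‖ ≤ 1
    · rw [hf0 m z hz1, zero_mul]
    have hzX : z ∈ X := ⟨hz, not_le.mp hz1⟩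
    have hz2 : z ∉ V m ∨ z ∉ V n := by
      by_contra! hc
      have hd : Disjoint (O m) (O n) := hOd hmn
      rw [← hVO m, ← hVO n] at hd
      exact (hd.notMem_of_mem_left (a := (⟨z, hzX⟩ : X)) hc.1) hc.2
    rcases hz2 with h | h
    · have h0 : u m z = 0 := hu0 m h
      simp [f, h0]
    · have h0 : u n z = 0 := hu0 n h
      simp [f, h0]
  have hne : ∀ n, ∃ x, cfc (f n) W x ≠ 0 := fun n => by
    by_contra! hc
    have h0 : cfc (f n) W = 0 := ContinuousLinearMap.ext hc
    have := norm_apply_le_norm_cfc (f n) W (p n).2.1 (hfc n).continuousOn hW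
    rw [h0, norm_zero] at this
    exact hfp n (norm_le_zero_iff.mp this)
  choose x hx using hne
  let v : ℕ → H := fun n => ((‖cfc (f n) W (x n)‖⁻¹ : ℝ) : ℂ) • cfc (f n) W (x n)
  have hadj : ∀ n, star (cfc (f n) W) = cfc (f n) W := fun n => by
    rw [← cfc_star]
    exact cfc_congr fun z _ => by simp [f]
  have hv : Orthonormal ℂ v := by
    refine ⟨fun n => ?_, fun m n hmn => ?_⟩
    · have := norm_ne_zero_iff.mpr (hx n)
      simp only [v, norm_smul, Complex.norm_real, norm_inv, norm_norm]
      exact inv_mul_cancel₀ this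
    · have h0 : cfc (f m) W * cfc (f n) W = 0 := by
        rw [← cfc_mul _ _ W (hfc m).continuousOn (hfc n).continuousOn,
          cfc_congr (g := fun _ => 0) (hfm m n hmn)]
        simp
      have h1 : inner ℂ (cfc (f m) W (x m)) (cfc (f n) W (x n)) = 0 := by
        conv_lhs => rw [← hadj m, ContinuousLinearMap.star_eq_adjoint]
        rw [ContinuousLinearMap.adjoint_inner_left, ← mul_apply_eq_comp, h0]
        simp
      simp only [v, inner_smul_left, inner_smul_right, h1, mul_zero]
  have hbig : ∀ n, 1 ≤ ‖(W - 1) (v n)‖ := fun n => by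
    have hle : ‖cfc (f n) W (x n)‖ ≤ ‖cfc (fun z => (z - 1) * f n z) W (x n)‖ := by
      refine norm_cfc_apply_le (hfc n).continuousOn
        (by have := hfc n; fun_prop) (fun z _ => ?_) _
      rw [norm_mul]
      by_cases hz1 : ‖z - 1‖ ≤ 1
      · simp [hf0 n z hz1]
      · exact le_mul_of_one_le_left (norm_nonneg _) (not_le.mp hz1).le
    have hW1 : cfc (fun z : ℂ => z - 1) W = W - 1 := by
      rw [cfc_sub .., cfc_id' ℂ W, cfc_const_one ℂ W]
    rw [cfc_mul _ _ W (by fun_prop) (hfc n).continuousOn, hW1,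
      mul_apply_eq_comp] at hle
    have hpos := norm_pos_iff.mpr (hx n)
    simp only [v, map_smul, norm_smul, Complex.norm_real, norm_inv, norm_norm]
    rwa [inv_mul_eq_div, one_le_div hpos]
  exact not_finite_iff_infinite.mpr inferInstance (finite_of_orthonormal_of_one_le hT hv hbig)

theorem continuousOn_arg_spectrum {W : H →L[ℂ] H} (hW : W ∈ unitary (H →L[ℂ] H))
    (hT : IsHilbertSchmidt (W - 1)) :
    ContinuousOn (fun z : ℂ => (Complex.arg z : ℂ)) (spectrum ℂ W) := by
  have : IsStarNormal W := isStarNormal_of_mem_unitary hW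
  have hfin := finite_spectrum_of_isHilbertSchmidt_sub_one hT
  intro z hz
  by_cases h : 1 < ‖z - 1‖
  · -- Such a `z` is isolated in the spectrum.
    have hcl := (hfin.subset Set.sdiff_subset : ({y ∈ spectrum ℂ W | 1 < ‖y - 1‖} \ {z}).Finite)
      |>.isClosed
    have ho : IsOpen {y : ℂ | 1 < ‖y - 1‖} := isOpen_lt (by fun_prop) (by fun_prop)
    have hN := (ho.inter hcl.isOpen_compl).mem_nhds (x := z) ⟨h, fun hz' => hz'.2 rfl⟩
    refine continuousWithinAt_singleton.mono_of_mem_nhdsWithin ?_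
    filter_upwards [self_mem_nhdsWithin, mem_nhdsWithin_of_mem_nhds hN] with y hy hy'
    by_contra hyz
    exact hy'.2 ⟨⟨hy, hy'.1⟩, hyz⟩
  · -- On the unit circle `arg` jumps only at `-1`, whose distance from `1` is `2`.
    refine (Complex.continuous_ofReal.continuousAt.comp
      (Complex.continuousAt_arg ?_)).continuousWithinAt
    have h1 : ‖z‖ = 1 := spectrum.norm_eq_one_of_unitary hW hz
    by_contra hs
    have hz1 : z = -1 := by
      have := Complex.mem_slitPlane_iff_arg.not.mp hs
      have hz0 : z ≠ 0 := norm_ne_zero_iff.mp (by rw [h1]; exact one_ne_zero)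
      have harg : z.arg = Real.pi := by tauto
      rw [← Complex.norm_mul_exp_arg_mul_I z, h1, harg, Complex.exp_pi_mul_I]
      simp
    rw [hz1] at h
    norm_num at h

/-! ### The logarithm -/

theorem abs_arg_le_norm_sub_one {z : ℂ} (hz : ‖z‖ = 1) :
    |z.arg| ≤ Real.pi / 2 * ‖z - 1‖ := by
  have hz0 : z ≠ 0 := norm_ne_zero_iff.mp (by rw [hz]; exact one_ne_zero)
  rw [← Complex.angle_one_right hz0]
  exact Complex.angle_le_mul_norm_sub hz norm_one

end Lemmas

theorem theorem2p1 {H : Type*} [NormedAddCommGroup H] [InnerProductSpace ℂ H] [CompleteSpace H]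
    [TopologicalSpace.SeparableSpace H] (U U₀ : H →L[ℂ] H)
    (hU : U ∈ unitary (H →L[ℂ] H)) (hU₀ : U₀ ∈ unitary (H →L[ℂ] H))
    (hdiff : IsHilbertSchmidt (U - U₀)) :
    ∃ A : H →L[ℂ] H, IsSelfAdjoint A ∧ IsHilbertSchmidt A ∧
      U = NormedSpace.exp (Complex.I • A) * U₀ ∧
      spectrum ℂ A ⊆ Complex.ofReal '' Set.Ioc (-Real.pi) Real.pi ∧
      hsNorm A ≤ Real.pi / 2 * hsNorm (U - U₀) := by
  set W : H →L[ℂ] H := U * star U₀ with hWdef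
  have hW : W ∈ unitary (H →L[ℂ] H) := mul_mem hU (Unitary.star_mem hU₀)
  have hn : IsStarNormal W := isStarNormal_of_mem_unitary hW
  have hW1 : W - 1 = (U - U₀) * star U₀ := by
    rw [sub_mul, Unitary.mul_star_self_of_mem hU₀]
  have hT : IsHilbertSchmidt (W - 1) := by
    rw [hW1]
    exact (isHilbertSchmidt_mul_star_unitary hU₀).mpr hdiff
  have harg := continuousOn_arg_spectrum hW hT
  set A : H →L[ℂ] H := cfc (fun z : ℂ => (Complex.arg z : ℂ)) W with hA
  have hAsa : IsSelfAdjoint A := IsSelfAdjoint.cfc_arg W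
  have hle : ∀ x, ‖A x‖ ≤ Real.pi / 2 * ‖(W - 1) x‖ := fun x => by
    have h1 : cfc (fun z : ℂ => ((Real.pi / 2 : ℝ) : ℂ) * (z - 1)) W =
        ((Real.pi / 2 : ℝ) : ℂ) • (W - 1) := by
      rw [cfc_const_mul .., cfc_sub .., cfc_id' ℂ W, cfc_const_one ℂ W]
    have h2 := norm_cfc_apply_le harg
      (g := fun z : ℂ => ((Real.pi / 2 : ℝ) : ℂ) * (z - 1)) (by fun_prop) (fun z hz => ?_) x
    · rwa [h1, smul_apply, norm_smul, Complex.norm_real,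
        Real.norm_of_nonneg (by positivity)] at h2
    · rw [norm_mul, Complex.norm_real, Complex.norm_real,
        Real.norm_of_nonneg (show (0 : ℝ) ≤ Real.pi / 2 by positivity)]
      exact abs_arg_le_norm_sub_one (spectrum.norm_eq_one_of_unitary hW hz)
  have hexp : NormedSpace.exp (Complex.I • A) = W := by
    have hs : IsStarNormal (Complex.I • A) := by
      rw [hA, ← cfc_smul ..]
      exact cfc_predicate _ _
    have hAn : IsStarNormal A := hAsa.isStarNormal
    rw [← CFC.complex_exp_eq_normedSpace_exp hs, ← cfc_comp_smul Complex.I _ A,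
      hA, ← cfc_comp' ..]
    conv_rhs => rw [← cfc_id' ℂ W]
    refine cfc_congr fun z hz => ?_
    have h1 : ‖z‖ = 1 := spectrum.norm_eq_one_of_unitary hW hz
    have h2 := Complex.norm_mul_exp_arg_mul_I z
    rw [h1, Complex.ofReal_one, one_mul] at h2
    simpa [mul_comm] using h2
  refine ⟨A, hAsa, isHilbertSchmidt_of_norm_le hle hT, ?_, ?_, ?_⟩
  · rw [hexp, hWdef, mul_assoc, Unitary.star_mul_self_of_mem hU₀, mul_one]
  · rw [hA, cfc_map_spectrum ..]
    rintro _ ⟨z, -, rfl⟩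
    exact ⟨z.arg, Complex.arg_mem_Ioc z, rfl⟩
  · have := hsNorm_le_of_norm_le (by positivity) hle hT
    rwa [hW1, hsNorm_mul_star_unitary _ hU₀] at this
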